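/- Let $M=M_{[0,1]}$ be the set of continuous nondecreasing functions $f:[0,1]\to[0,1]$ with $\inf f=0$ and $\sup f=1$, with the sup metric $d$. For $\alpha\in[0,1]$ and $f,g\in M$, let $\varphi_\alpha(f,g)$ be the first coordinate of the unique point $(a,b)\in\{(f(t),g(t)):t\in[0,1]\}$ with $a+b=\alpha$. A predicate $P:M^V\to[0,1]$ ($V$ a set of variables) is called definable if it is a uniform limit of (interpretations of) continuous-logic formulas, without parameters, in the language consisting of $d$ and the predicates $\varphi_q$, $q\in[0,1]\cap\mathbb Q$; formulas are built with arbitrary continuous connectives $[0,1]^m\to[0,1]$ and the quantifiers $\inf$ and $\sup$. For a definable predicate $\varphi(x;y)$ on $M$ and $\varepsilon>0$, a finite set $\Psi$ of definable predicates $\psi(x;y_1,\dots,y_k)$ weakly defines an $\varepsilon$-distal cell decomposition over $M$ for $\varphi$ if for every finite $B\subseteq M$ with $|B|\ge 2$ and every $a\in M$ there are $\psi\in\Psi$ and $b_1,\dots,b_k\in B$ such that $\psi(a;b_1,\dots,b_k)>0$ and, for every $a'\in M$, $\psi(a';b_1,\dots,b_k)>0$ implies $|\varphi(a;c)-\varphi(a';c)|\le\varepsilon$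 for all $c\in B$. If such a $\Psi$ exists (for some $k$), $\varphi$ admits an $\varepsilon$-distal cell decomposition over $M$. Theorem. Let $\alpha\in[0,1]$ and $\varepsilon>0$. Then $\varphi_\alpha(x;y)$ is a definable predicate and admits an $\varepsilon$-distal cell decomposition over $M$. One is explicitly given as follows. Let $n\ge1$ with $2/n\le\varepsilon$. For $0\le i\le n$ there are continuous functions $F_{i-},F_{i+}:[0,1]\to[0,1]$ which are nonzero exactly on $[0,\frac in)$, respectively exactly on $(\frac in,1]$. Fix any such functions, and let $\Psi$ be the finite set of all predicates $$\psi(x;(y_{i-},y_{i+})_{0\le i\le n})=\bigwedge_{i=0}^n\bigl(\psi_{i-}\wedge\psi_{i+}\bigr),$$ where $\wedge$ is the minimum and each $\psi_{i\pm}$ is either the constant $1$ or $F_{i\pm}(\varphi_\alpha(x;y_{i\pm}))$. Then $\Psi$ weakly defines an $\varepsilon$-distal cell decomposition over $M$ for $\varphi_\alpha$. More precisely, let $B\subseteq M$ be finite with $|B|\ge2$ and let $a\in M$. Choose parameters $b_{i\pm}\in B$ as follows, which is possible (suprema and infima are taken in $[0,1]$, so $\sup\emptyset=0$ and $\inf\emptyset=1$):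 * if some $c\in B$ has $\varphi_\alpha(a;c)<\frac in$, then $b_{i-}$ maximizes $\sup c^{-1}(\{\alpha-\frac in\})$ among these $c$; * if some $c\in B$ has $\varphi_\alpha(a;c)>\frac in$, then $b_{i+}$ minimizes $\inf c^{-1}(\{\alpha-\frac in\})$ among these $c$; * the remaining $b_{i\pm}$ are arbitrary elements of $B$. Let $\psi\in\Psi$ be the predicate in which $\psi_{i-}$ (respectively $\psi_{i+}$) is the constant $1$ exactly when no $c\in B$ has $\varphi_\alpha(a;c)<\frac in$ (respectively $>\frac in$). Then for every such choice $b=(b_{i\pm})$ one has $\psi(a;b)>0$, and for every $a'\in M$, $\psi(a';b)>0$ implies $|\varphi_\alpha(a;c)-\varphi_\alpha(a';c)|\le\varepsilon$ for all $c\in B$. -/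

import Mathlib

open Set
open scoped unitInterval

noncomputable section

namespace DualContinuum

/-- The set `M_L` of continuous nondecreasing functions from a linear order `L` to `[0,1]` with
infimum `0` and supremum `1`. -/
structure MonoFun (L : Type) [LinearOrder L] [TopologicalSpace L] [OrderTopology L] where
  toFun : L → I
  monotone' : Monotone toFun
  continuous' : Continuous toFun
  isGLB' : IsGLB (range toFun) 0
  isLUB' : IsLUB (range toFun) 1

instance (L : Type) [LinearOrder L] [TopologicalSpace L] [OrderTopology L] :
    CoeFun (MonoFun L) (fun _ => L → I) := ⟨MonoFun.toFun⟩

/-- The sup metric on `M_L`; it takes values in `[0,1]`. -/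
def supDist {L : Type} [LinearOrder L] [TopologicalSpace L] [OrderTopology L]
    (f g : MonoFun L) : I :=
  ⟨⨆ t : L, |(f t : ℝ) - (g t : ℝ)|, Real.iSup_nonneg fun _ => abs_nonneg _,
    Real.iSup_le (fun t => abs_sub_le_iff.2
      ⟨by linarith [(f t).2.2, (g t).2.1], by linarith [(f t).2.1, (g t).2.2]⟩) zero_le_one⟩

/-- The underlying set of the structure `M_{[0,1]}`. -/
abbrev M01 : Type := MonoFun I

/-- The image of the pair `(f, g)` in `[0,1]²`. -/
def im (f g : M01) : Set (I × I) := range fun t : I => (f t, g t)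

theorem M01.map_zero (f : M01) : f 0 = 0 := by
  refine le_antisymm (f.isGLB'.2 ?_) unitInterval.nonneg'
  rintro _ ⟨t, rfl⟩
  exact f.monotone' unitInterval.nonneg'

theorem M01.map_one (f : M01) : f 1 = 1 := by
  refine le_antisymm unitInterval.le_one' (f.isLUB'.2 ?_)
  rintro _ ⟨t, rfl⟩
  exact f.monotone' unitInterval.le_one'

/-- For `α ∈ [0,1]` there is exactly one point `(a, b)` of the image with `a + b = α`. -/
theorem existsUnique_mem_im (α : I) (f g : M01) :
    ∃! p : I × I, p ∈ im f g ∧ (p.1 : ℝ) + (p.2 : ℝ) = α := by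
  have hc : Continuous fun t : I => (f t : ℝ) + (g t : ℝ) :=
    (continuous_subtype_val.comp f.continuous').add (continuous_subtype_val.comp g.continuous')
  have hα : (α : ℝ) ∈ Icc ((f 0 : ℝ) + (g 0 : ℝ)) ((f 1 : ℝ) + (g 1 : ℝ)) := by
    simp only [M01.map_zero, M01.map_one, Set.Icc.coe_zero, Set.Icc.coe_one, mem_Icc]
    exact ⟨by linarith [α.2.1], by linarith [α.2.2]⟩
  obtain ⟨t, ht⟩ := intermediate_value_univ 0 1 hc hα
  refine ⟨(f t, g t), ⟨⟨t, rfl⟩, ht⟩, ?_⟩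
  rintro _ ⟨⟨s, rfl⟩, hs⟩
  dsimp only at hs ht
  rcases le_total s t with h | h
  · have h1 : (f s : ℝ) ≤ f t := f.monotone' h
    have h2 : (g s : ℝ) ≤ g t := g.monotone' h
    exact Prod.ext (Subtype.ext (show (f s : ℝ) = f t by linarith))
      (Subtype.ext (show (g s : ℝ) = g t by linarith))
  · have h1 : (f t : ℝ) ≤ f s := f.monotone' h
    have h2 : (g t : ℝ) ≤ g s := g.monotone' h
    exact Prod.ext (Subtype.ext (show (f s : ℝ) = f t by linarith))
      (Subtype.ext (show (g s : ℝ) = g t by linarith))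

/-- The basic predicate `φ_α`: the first coordinate `a` of the unique point `(a, b)` of the image
of `(f, g)` with `a + b = α`. -/
def phi (α : I) (f g : M01) : I := (existsUnique_mem_im α f g).choose.1

theorem phi_eq_iff (α : I) (f g : M01) (a : I) :
    phi α f g = a ↔ ∃ b : I, (a, b) ∈ im f g ∧ (a : ℝ) + (b : ℝ) = α := by
  have h := (existsUnique_mem_im α f g).choose_spec
  constructor
  · rintro rfl
    exact ⟨_, h.1⟩
  · rintro ⟨b, hb⟩
    exact (congrArg Prod.fst (h.2 (a, b) hb)).symm

/-- Continuous-logic formulas, with free variables in `V`, in the language consisting of the metric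
and of the binary predicate symbols `φ_q` for rational `q ∈ [0,1]`. The connectives are all the
continuous maps `[0,1]^m → [0,1]`, the quantifiers are `inf` and `sup`; the quantified variable
is `none : Option V`. -/
inductive Formula : Type → Type 1
  | dist {V : Type} (x y : V) : Formula V
  | pred {V : Type} (q : ℚ) (hq : (q : ℝ) ∈ Icc (0 : ℝ) 1) (x y : V) : Formula V
  | conn {V : Type} {m : ℕ} (u : C(Fin m → I, I)) (θ : Fin m → Formula V) : Formula V
  | inf {V : Type} (θ : Formula (Option V)) : Formula V
  | sup {V : Type} (θ : Formula (Option V)) : Formula V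

/-- The value in `M_{[0,1]}` of a formula under an assignment of its free variables. -/
def Formula.realize : {V : Type} → Formula V → (V → M01) → I
  | _, .dist x y, v => supDist (v x) (v y)
  | _, .pred q hq x y, v => phi ⟨(q : ℝ), hq⟩ (v x) (v y)
  | _, .conn u θ, v => u fun j => (θ j).realize v
  | _, .inf θ, v => ⨅ c : M01, θ.realize fun o => o.elim c v
  | _, .sup θ, v => ⨆ c : M01, θ.realize fun o => o.elim c v

/-- Definable predicates (without parameters) on `M_{[0,1]}^V`: the uniform limits of formulas. -/
def IsDefinable {V : Type} (P : (V → M01) → I) : Prop :=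
  ∀ δ : ℝ, 0 < δ → ∃ θ : Formula V, ∀ v : V → M01, |(P v : ℝ) - (θ.realize v : ℝ)| ≤ δ

/-- A predicate `ψ(x; (y_j)_{j ∈ J})` is definable; `none` is the variable `x`, `some j` is `y_j`. -/
def IsDefinableFamily {J : Type} (ψ : M01 → (J → M01) → I) : Prop :=
  IsDefinable fun v : Option J → M01 => ψ (v none) fun j => v (some j)

/-- `ψ(x; b)` is a cell containing `a` on which no `φ(x; c)`, `c ∈ B`, differs by more than `ε`
from its value at `a`. -/
def IsGoodCell {J : Type} (ε : ℝ) (φ : M01 → M01 → I) (B : Finset M01) (a : M01)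
    (ψ : M01 → (J → M01) → I) (b : J → M01) : Prop :=
  0 < ψ a b ∧ ∀ a' : M01, 0 < ψ a' b → ∀ c ∈ B, |(φ a c : ℝ) - (φ a' c : ℝ)| ≤ ε

/-- The finite set `Ψ` of definable predicates `ψ(x; (y_j)_{j ∈ J})` weakly defines an `ε`-distal
cell decomposition over `M_{[0,1]}` for the definable predicate `φ(x; y)`. -/
structure WeaklyDefines {J : Type} (Ψ : Set (M01 → (J → M01) → I)) (ε : ℝ)
    (φ : M01 → M01 → I) : Prop where
  definable_pred : IsDefinable fun v : Fin 2 → M01 => φ (v 0) (v 1)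
  finite : Ψ.Finite
  definable : ∀ ψ ∈ Ψ, IsDefinableFamily ψ
  cell : ∀ B : Finset M01, 2 ≤ B.card → ∀ a : M01,
    ∃ ψ ∈ Ψ, ∃ b : J → M01, (∀ j, b j ∈ B) ∧ IsGoodCell ε φ B a ψ b

/-- `φ` admits an `ε`-distal cell decomposition over `M_{[0,1]}`. -/
def AdmitsDistalCellDecomposition (ε : ℝ) (φ : M01 → M01 → I) : Prop :=
  ∃ (k : ℕ) (Ψ : Set (M01 → (Fin k → M01) → I)), WeaklyDefines Ψ ε φ

/-- Continuous functions `F_{i-}`, `F_{i+}` from `[0,1]` to `[0,1]`, for `0 ≤ i ≤ n`, that are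
nonzero exactly on `[0, i/n)` and exactly on `(i/n, 1]` respectively. -/
structure CutoffFamily (n : ℕ) where
  minus : Fin (n + 1) → C(I, I)
  plus : Fin (n + 1) → C(I, I)
  support_minus : ∀ i, Function.support (minus i) = {s : I | (s : ℝ) < (i : ℝ) / n}
  support_plus : ∀ i, Function.support (plus i) = {s : I | (i : ℝ) / n < (s : ℝ)}

/-- The predicate `⋀_{i ≤ n} (ψ_{i-}(x) ∧ ψ_{i+}(x))` where `ψ_{i-}` is `F_{i-}(φ_α(x; y_{i-}))` for
`i ∈ S`, and the constant `1` otherwise, and `ψ_{i+}` is `F_{i+}(φ_α(x; y_{i+}))` for `i ∈ T`, and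
`1` otherwise. The variable `y_{i-}` is `y (.inl i)`, the variable `y_{i+}` is `y (.inr i)`. -/
def cellPredicate {n : ℕ} (α : I) (F : CutoffFamily n) (S T : Set (Fin (n + 1)))
    (x : M01) (y : Fin (n + 1) ⊕ Fin (n + 1) → M01) : I :=
  open scoped Classical in
  ⨅ i : Fin (n + 1),
    min (if i ∈ S then F.minus i (phi α x (y (.inl i))) else 1)
      (if i ∈ T then F.plus i (phi α x (y (.inr i))) else 1)

/-- The explicit finite set of predicates. -/
def cellPredicates {n : ℕ} (α : I) (F : CutoffFamily n) :
    Set (M01 → (Fin (n + 1) ⊕ Fin (n + 1) → M01) → I) :=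
  {ψ | ∃ S T : Set (Fin (n + 1)), ψ = cellPredicate α F S T}

/-- The elements `c ∈ B` with `φ_α(a; c) < i/n`. -/
def below (n : ℕ) (α : I) (B : Finset M01) (a : M01) (i : Fin (n + 1)) : Set M01 :=
  {c | c ∈ B ∧ (phi α a c : ℝ) < (i : ℝ) / n}

/-- The elements `c ∈ B` with `φ_α(a; c) > i/n`. -/
def above (n : ℕ) (α : I) (B : Finset M01) (a : M01) (i : Fin (n + 1)) : Set M01 :=
  {c | c ∈ B ∧ (i : ℝ) / n < (phi α a c : ℝ)}

/-- The preimage `c⁻¹({α - i/n})`. -/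
def levelSet (n : ℕ) (α : I) (i : Fin (n + 1)) (c : M01) : Set I :=
  {t | (c t : ℝ) = (α : ℝ) - (i : ℝ) / n}

/-- The parameters are chosen from `B` as follows: `b_{i-}` maximizes `sup c⁻¹({α - i/n})` among the
`c ∈ B` with `φ_α(a; c) < i/n`, and `b_{i+}` minimizes `inf c⁻¹({α - i/n})` among the `c ∈ B` with
`φ_α(a; c) > i/n`, whenever there are such `c`; the other parameters are arbitrary in `B`.
Suprema and infima are taken in `[0,1]`. -/
structure IsExtremalChoice (n : ℕ) (α : I) (B : Finset M01) (a : M01)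
    (b : Fin (n + 1) ⊕ Fin (n + 1) → M01) : Prop where
  mem : ∀ j, b j ∈ B
  minus_mem : ∀ i, (below n α B a i).Nonempty → b (.inl i) ∈ below n α B a i
  minus_max : ∀ i, ∀ c ∈ below n α B a i,
    sSup (levelSet n α i c) ≤ sSup (levelSet n α i (b (.inl i)))
  plus_mem : ∀ i, (above n α B a i).Nonempty → b (.inr i) ∈ above n α B a i
  plus_min : ∀ i, ∀ c ∈ above n α B a i,
    sInf (levelSet n α i (b (.inr i))) ≤ sInf (levelSet n α i c)

end DualContinuum

end

open Set
open scoped unitInterval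

namespace DualContinuum

/-! Let `r ≤ α` and let `s` be the last point where `c` equals `α - r`. The antidiagonal of sum `α`
meets the image of `(a, c)` at a first coordinate below `r` exactly when `a s < r`; the first such
point governs `r < φ_α(a; c)` in the same way (`phi_lt_iff`, `lt_phi_iff`). So each threshold
condition tests `a` at a single point of `[0,1]`. As `a` is nondecreasing, among the conditions
`φ_α(a; c) < r` true at `a` the one with the largest test point implies all the others, and dually
for the smallest.

A cell built from these extremal conditions at the thresholds `i/n` therefore passes every strict
inequality with some `i/n` from `φ_α(a; c)` to `φ_α(a'; c)`, which forces the two values within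
`2/n` (`abs_sub_le_of_lt_div`). Definability holds because `φ_α` is 1-Lipschitz in `α`, uniformly in
its arguments, and connectives are uniformly continuous. -/

/-! ### Threshold conditions as tests at one point -/

theorem exists_phi_eq (α : I) (f g : M01) :
    ∃ t : I, phi α f g = f t ∧ (f t : ℝ) + (g t : ℝ) = α := by
  obtain ⟨b, ⟨t, ht⟩, h⟩ := (phi_eq_iff α f g (phi α f g)).1 rfl
  obtain ⟨h1, rfl⟩ := Prod.mk.inj ht
  exact ⟨t, h1.symm, by rw [← h1] at h; exact h⟩

theorem phi_le (α : I) (f g : M01) : (phi α f g : ℝ) ≤ α := by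
  obtain ⟨t, h, ht⟩ := exists_phi_eq α f g
  rw [h]
  linarith [(g t).2.1]

/-- If `s` is the last point at which `c` is at most `α - r`, then `φ_α(a; c) < r` depends only on
the value of `a` at `s`. -/
theorem phi_lt_iff {α : I} {a c : M01} {r : ℝ} {s : I} (hs : (c s : ℝ) = α - r)
    (hmax : ∀ t, (c t : ℝ) = α - r → t ≤ s) : (phi α a c : ℝ) < r ↔ (a s : ℝ) < r := by
  obtain ⟨t, h, ht⟩ := exists_phi_eq α a c
  rw [h]
  constructor
  · intro hlt
    have hst : s ≤ t := by
      by_contra! hts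
      have : (c t : ℝ) ≤ c s := c.monotone' hts.le
      linarith
    have : (a s : ℝ) ≤ a t := a.monotone' hst
    linarith
  · intro hlt
    have hst : s < t := by
      by_contra! hts
      have h1 : (c t : ℝ) ≤ c s := c.monotone' hts
      have h2 : (a t : ℝ) ≤ a s := a.monotone' hts
      linarith
    have h1 : (c s : ℝ) ≤ c t := c.monotone' hst.le
    -- Beyond the last point of the level, `c t > α - r` strictly, hence `a t < r`.
    have h2 : (c t : ℝ) ≠ α - r := fun h2 => (hmax t h2).not_gt hst
    have h3 := lt_of_le_of_ne (hs ▸ h1) h2.symm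
    linarith

/-- If `s` is the first point at which `c` is at least `α - r`, then `r < φ_α(a; c)` depends only on
the value of `a` at `s`. -/
theorem lt_phi_iff {α : I} {a c : M01} {r : ℝ} {s : I} (hs : (c s : ℝ) = α - r)
    (hmin : ∀ t, (c t : ℝ) = α - r → s ≤ t) : r < (phi α a c : ℝ) ↔ r < (a s : ℝ) := by
  obtain ⟨t, h, ht⟩ := exists_phi_eq α a c
  rw [h]
  constructor
  · intro hlt
    have hst : t ≤ s := by
      by_contra! hts
      have : (c s : ℝ) ≤ c t := c.monotone' hts.le
      linarith
    have : (a t : ℝ) ≤ a s := a.monotone' hst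
    linarith
  · intro hlt
    have hst : t < s := by
      by_contra! hts
      have h1 : (c s : ℝ) ≤ c t := c.monotone' hts
      have h2 : (a s : ℝ) ≤ a t := a.monotone' hts
      linarith
    have h1 : (c t : ℝ) ≤ c s := c.monotone' hst.le
    have h2 : (c t : ℝ) ≠ α - r := fun h2 => (hmin t h2).not_gt hst
    have h3 := lt_of_le_of_ne (hs ▸ h1) h2
    linarith

theorem isCompact_levelSet (n : ℕ) (α : I) (i : Fin (n + 1)) (c : M01) :
    IsCompact (levelSet n α i c) :=
  (isClosed_eq (continuous_subtype_val.comp c.continuous') continuous_const).isCompact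

theorem levelSet_nonempty {n : ℕ} {α : I} {i : Fin (n + 1)} (h : (i : ℝ) / n ≤ α) (c : M01) :
    (levelSet n α i c).Nonempty := by
  have hα : (α : ℝ) - (i : ℝ) / n ∈ Icc ((c 0 : ℝ)) (c 1 : ℝ) := by
    simp only [M01.map_zero, M01.map_one, Set.Icc.coe_zero, Set.Icc.coe_one, mem_Icc]
    have : 0 ≤ (i : ℝ) / n := by positivity
    exact ⟨by linarith, by linarith [α.2.2]⟩
  obtain ⟨t, ht⟩ := intermediate_value_univ 0 1
    (continuous_subtype_val.comp c.continuous') hα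
  exact ⟨t, ht⟩

theorem phi_lt_iff_sSup {n : ℕ} {α : I} {i : Fin (n + 1)} (h : (i : ℝ) / n ≤ α) (a c : M01) :
    (phi α a c : ℝ) < (i : ℝ) / n ↔ (a (sSup (levelSet n α i c)) : ℝ) < (i : ℝ) / n :=
  phi_lt_iff ((isCompact_levelSet n α i c).sSup_mem (levelSet_nonempty h c))
    fun _ ht => le_sSup ht

theorem lt_phi_iff_sInf {n : ℕ} {α : I} {i : Fin (n + 1)} (h : (i : ℝ) / n ≤ α) (a c : M01) :
    (i : ℝ) / n < (phi α a c : ℝ) ↔ (i : ℝ) / n < (a (sInf (levelSet n α i c)) : ℝ) :=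
  lt_phi_iff ((isCompact_levelSet n α i c).sInf_mem (levelSet_nonempty h c))
    fun _ ht => sInf_le ht

/-- Being small at a later test point is the stronger condition on a nondecreasing `a`. -/
theorem phi_lt_of_sSup_le {n : ℕ} {α : I} {i : Fin (n + 1)} {a b c : M01}
    (hb : (phi α a b : ℝ) < (i : ℝ) / n)
    (hbc : sSup (levelSet n α i c) ≤ sSup (levelSet n α i b)) :
    (phi α a c : ℝ) < (i : ℝ) / n := by
  rcases le_or_gt ((i : ℝ) / n) α with h | h
  · rw [phi_lt_iff_sSup h] at hb ⊢
    exact lt_of_le_of_lt (a.monotone' hbc) hb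
  -- For a threshold above `α` the level sets are empty and the condition holds automatically.
  · exact (phi_le α a c).trans_lt h

theorem lt_phi_of_sInf_le {n : ℕ} {α : I} {i : Fin (n + 1)} {a b c : M01}
    (hb : (i : ℝ) / n < (phi α a b : ℝ))
    (hbc : sInf (levelSet n α i b) ≤ sInf (levelSet n α i c)) :
    (i : ℝ) / n < (phi α a c : ℝ) := by
  have h : (i : ℝ) / n ≤ α := hb.le.trans (phi_le α a b)
  rw [lt_phi_iff_sInf h] at hb ⊢
  exact hb.trans_le (a.monotone' hbc)

/-! ### Separation by multiples of `1/n` -/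

/-- Two points of the unit interval that are more than `2 / n` apart are separated by a multiple of
`1 / n`. -/
theorem exists_div_mem_Ico {n : ℕ} (hn : 0 < n) {s t : I} (h : (s : ℝ) + 2 / n < t) :
    ∃ i : Fin (n + 1), (s : ℝ) < (i : ℝ) / n ∧ (i : ℝ) / n < t := by
  have hn' : (0 : ℝ) < n := by exact_mod_cast hn
  have h2 : (s : ℝ) * n + 2 < t * n := by
    have := mul_lt_mul_of_pos_right h hn'
    rwa [add_mul, div_mul_cancel₀ _ hn'.ne'] at this
  have h3 : (0 : ℝ) ≤ s * n := mul_nonneg s.2.1 hn'.le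
  have h4 := Nat.floor_le h3
  have h5 := Nat.lt_floor_add_one ((s : ℝ) * n)
  have h6 : (t : ℝ) * n ≤ n := mul_le_of_le_one_left hn'.le t.2.2
  have h7 : ⌊(s : ℝ) * n⌋₊ + 1 < n + 1 := by
    have : ((⌊(s : ℝ) * n⌋₊ + 1 : ℕ) : ℝ) < ((n + 1 : ℕ) : ℝ) := by
      push_cast
      linarith
    exact_mod_cast this
  -- The first multiple of `1/n` strictly above `s`; it is at most `s + 1/n`, so a gap of `2/n`
  -- leaves room to spare.
  refine ⟨⟨⌊(s : ℝ) * n⌋₊ + 1, h7⟩, ?_, ?_⟩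
  · rw [lt_div_iff₀ hn']
    push_cast
    exact h5
  · rw [div_lt_iff₀ hn']
    push_cast
    linarith

theorem abs_sub_le_of_lt_div {n : ℕ} (hn : 0 < n) {s t : I}
    (h1 : ∀ i : Fin (n + 1), (s : ℝ) < (i : ℝ) / n → (t : ℝ) < (i : ℝ) / n)
    (h2 : ∀ i : Fin (n + 1), (i : ℝ) / n < s → (i : ℝ) / n < (t : ℝ)) :
    |(s : ℝ) - t| ≤ 2 / n := by
  rw [abs_sub_le_iff]
  constructor
  · by_contra! h
    obtain ⟨i, hi, hi'⟩ := exists_div_mem_Ico hn (s := t) (t := s) (by linarith)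
    exact lt_asymm hi (h2 i hi')
  · by_contra! h
    obtain ⟨i, hi, hi'⟩ := exists_div_mem_Ico hn (s := s) (t := t) (by linarith)
    exact lt_asymm hi' (h1 i hi)

/-! ### Cutoff functions, cells and extremal parameters -/

theorem CutoffFamily.minus_pos_iff {n : ℕ} (F : CutoffFamily n) (i : Fin (n + 1)) (s : I) :
    0 < F.minus i s ↔ (s : ℝ) < (i : ℝ) / n := by
  rw [unitInterval.pos_iff_ne_zero, ← Function.mem_support, F.support_minus, mem_ofPred_eq]

theorem CutoffFamily.plus_pos_iff {n : ℕ} (F : CutoffFamily n) (i : Fin (n + 1)) (s : I) :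
    0 < F.plus i s ↔ (i : ℝ) / n < (s : ℝ) := by
  rw [unitInterval.pos_iff_ne_zero, ← Function.mem_support, F.support_plus, mem_ofPred_eq]

theorem cutoffFamily_nonempty (n : ℕ) : Nonempty (CutoffFamily n) := by
  refine ⟨⟨fun i => ⟨fun s => projIcc 0 1 zero_le_one ((i : ℝ) / n - s), ?_⟩,
    fun i => ⟨fun s => projIcc 0 1 zero_le_one ((s : ℝ) - (i : ℝ) / n), ?_⟩, ?_, ?_⟩⟩
  · exact continuous_projIcc.comp (continuous_const.sub continuous_subtype_val)
  · exact continuous_projIcc.comp (continuous_subtype_val.sub continuous_const)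
  · intro i
    ext s
    simp only [Function.mem_support, ContinuousMap.coe_mk, mem_ofPred_eq, ne_eq]
    rw [show (0 : I) = ⟨0, left_mem_Icc.2 zero_le_one⟩ from rfl, projIcc_eq_left zero_lt_one,
      sub_nonpos, not_le]
  · intro i
    ext s
    simp only [Function.mem_support, ContinuousMap.coe_mk, mem_ofPred_eq, ne_eq]
    rw [show (0 : I) = ⟨0, left_mem_Icc.2 zero_le_one⟩ from rfl, projIcc_eq_left zero_lt_one,
      sub_nonpos, not_le]

theorem cellPredicate_pos_iff {n : ℕ} {α : I} {F : CutoffFamily n} {S T : Set (Fin (n + 1))}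
    {x : M01} {y : Fin (n + 1) ⊕ Fin (n + 1) → M01} :
    0 < cellPredicate α F S T x y ↔
      (∀ i ∈ S, (phi α x (y (.inl i)) : ℝ) < (i : ℝ) / n) ∧
      ∀ i ∈ T, (i : ℝ) / n < (phi α x (y (.inr i)) : ℝ) := by
  classical
  have key : 0 < cellPredicate α F S T x y ↔ ∀ i : Fin (n + 1),
      0 < min (if i ∈ S then F.minus i (phi α x (y (.inl i))) else 1)
        (if i ∈ T then F.plus i (phi α x (y (.inr i))) else 1) := by
    constructor
    · intro h i
      refine lt_of_lt_of_le h ((iInf_le _ i).trans_eq ?_)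
      congr
    · intro h
      -- A finite infimum is attained, so strict positivity survives.
      obtain ⟨i, hi⟩ := exists_eq_ciInf_of_finite (f := fun i : Fin (n + 1) =>
        min (if i ∈ S then F.minus i (phi α x (y (.inl i))) else 1)
          (if i ∈ T then F.plus i (phi α x (y (.inr i))) else 1))
      have h' := hi ▸ h i
      unfold cellPredicate
      convert h'
  rw [key, ← forall_and]
  refine forall_congr' fun i => ?_
  rw [lt_min_iff]
  refine and_congr ?_ ?_
  · split_ifs with h <;> simp [h, F.minus_pos_iff]
  · split_ifs with h <;> simp [h, F.plus_pos_iff]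

theorem isGoodCell_cellPredicate {n : ℕ} (hn : 0 < n) {ε : ℝ} (hε : 2 / (n : ℝ) ≤ ε) {α : I}
    (F : CutoffFamily n) {B : Finset M01} {a : M01} {b : Fin (n + 1) ⊕ Fin (n + 1) → M01}
    (hb : IsExtremalChoice n α B a b) :
    IsGoodCell ε (phi α) B a
      (cellPredicate α F {i | (below n α B a i).Nonempty} {i | (above n α B a i).Nonempty}) b := by
  refine ⟨cellPredicate_pos_iff.2 ⟨fun i hi => (hb.minus_mem i hi).2,
    fun i hi => (hb.plus_mem i hi).2⟩, fun a' ha' c hc => ?_⟩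
  obtain ⟨h1, h2⟩ := cellPredicate_pos_iff.1 ha'
  refine (abs_sub_le_of_lt_div hn (fun i hi => ?_) fun i hi => ?_).trans hε
  · exact phi_lt_of_sSup_le (h1 i ⟨c, hc, hi⟩) (hb.minus_max i c ⟨hc, hi⟩)
  · exact lt_phi_of_sInf_le (h2 i ⟨c, hc, hi⟩) (hb.plus_min i c ⟨hc, hi⟩)

theorem exists_isExtremalChoice (n : ℕ) (α : I) {B : Finset M01} (hB : B.Nonempty) (a : M01) :
    ∃ b, IsExtremalChoice n α B a b := by
  have h1 : ∀ i, ∃ b ∈ B, ((below n α B a i).Nonempty → b ∈ below n α B a i) ∧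
      ∀ c ∈ below n α B a i, sSup (levelSet n α i c) ≤ sSup (levelSet n α i b) := by
    intro i
    rcases (below n α B a i).eq_empty_or_nonempty with h | h
    · obtain ⟨b, hb⟩ := hB
      exact ⟨b, hb, by simp [h]⟩
    · obtain ⟨b, hb, hb'⟩ := exists_max_image _ (fun c => sSup (levelSet n α i c))
        (B.finite_toSet.subset fun c hc => hc.1) h
      exact ⟨b, hb.1, fun _ => hb, hb'⟩
  have h2 : ∀ i, ∃ b ∈ B, ((above n α B a i).Nonempty → b ∈ above n α B a i) ∧
      ∀ c ∈ above n α B a i, sInf (levelSet n α i b) ≤ sInf (levelSet n α i c) := by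
    intro i
    rcases (above n α B a i).eq_empty_or_nonempty with h | h
    · obtain ⟨b, hb⟩ := hB
      exact ⟨b, hb, by simp [h]⟩
    · obtain ⟨b, hb, hb'⟩ := exists_min_image _ (fun c => sInf (levelSet n α i c))
        (B.finite_toSet.subset fun c hc => hc.1) h
      exact ⟨b, hb.1, fun _ => hb, hb'⟩
  choose f hf hf1 hf2 using h1
  choose g hg hg1 hg2 using h2
  exact ⟨Sum.elim f g, ⟨by rintro (i | i); exacts [hf i, hg i], hf1, hf2, hg1, hg2⟩⟩

/-! ### Definability -/

/-- Both coordinates move in the same direction along the image, so the first changes by no more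
than the sum. This allows irrational `α` to be approximated by rational symbols. -/
theorem abs_phi_sub_phi_le (α β : I) (f g : M01) :
    |(phi α f g : ℝ) - phi β f g| ≤ |(α : ℝ) - β| := by
  obtain ⟨s, h1, hs⟩ := exists_phi_eq α f g
  obtain ⟨t, h2, ht⟩ := exists_phi_eq β f g
  rw [h1, h2]
  rcases le_total s t with h | h
  · have h3 : (f s : ℝ) ≤ f t := f.monotone' h
    have h4 : (g s : ℝ) ≤ g t := g.monotone' h
    rw [abs_of_nonpos (by linarith), abs_of_nonpos (by linarith)]
    linarith
  · have h3 : (f t : ℝ) ≤ f s := f.monotone' h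
    have h4 : (g t : ℝ) ≤ g s := g.monotone' h
    rw [abs_of_nonneg (by linarith), abs_of_nonneg (by linarith)]
    linarith

theorem exists_rat_mem_Icc_abs_sub_le (α : I) {δ : ℝ} (hδ : 0 < δ) :
    ∃ q : ℚ, (q : ℝ) ∈ Icc (0 : ℝ) 1 ∧ |(α : ℝ) - q| ≤ δ := by
  rcases eq_or_lt_of_le α.2.1 with h | h
  · exact ⟨0, by simp, by simp [← h, hδ.le]⟩
  · obtain ⟨q, hq1, hq2⟩ := exists_rat_btwn (show max 0 ((α : ℝ) - δ) < α from
      max_lt h (by linarith))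
    obtain ⟨h0, h1⟩ := max_lt_iff.1 hq1
    exact ⟨q, ⟨h0.le, hq2.le.trans α.2.2⟩, abs_sub_le_iff.2 ⟨by linarith, by linarith⟩⟩

theorem isDefinable_phi {V : Type} (α : I) (x y : V) :
    IsDefinable fun v : V → M01 => phi α (v x) (v y) := by
  intro δ hδ
  obtain ⟨q, hq, h⟩ := exists_rat_mem_Icc_abs_sub_le α hδ
  exact ⟨.pred q hq x y, fun v => (abs_phi_sub_phi_le α ⟨q, hq⟩ (v x) (v y)).trans h⟩

/-- Definable predicates are closed under continuous connectives. -/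
theorem IsDefinable.comp {V ι : Type} [Fintype ι] {P : ι → (V → M01) → I}
    (hP : ∀ j, IsDefinable (P j)) {u : (ι → I) → I} (hu : Continuous u) :
    IsDefinable fun v => u fun j => P j v := by
  intro δ hδ
  obtain ⟨η, hη, h⟩ := Metric.uniformContinuous_iff.1
    (CompactSpace.uniformContinuous_of_continuous hu) δ hδ
  -- Halving `η` turns the non-strict approximation bound into the strict one that uniform
  -- continuity needs.
  choose θ hθ using fun j => hP j (η / 2) (half_pos hη)
  let e := Fintype.equivFin ι
  refine ⟨.conn ⟨fun p => u fun j => p (e j), by fun_prop⟩ fun j => θ (e.symm j), fun v => ?_⟩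
  have h' := h (a := fun j => P j v) (b := fun j => (θ j).realize v) (by
    rw [dist_pi_lt_iff hη]
    exact fun j => (hθ j v).trans_lt (half_lt_self hη))
  simp only [Formula.realize, ContinuousMap.coe_mk, Equiv.symm_apply_apply]
  exact h'.le

theorem isDefinable_cellPredicate {n : ℕ} {V : Type} (α : I) (F : CutoffFamily n)
    (S T : Set (Fin (n + 1))) (x : V) (y : Fin (n + 1) ⊕ Fin (n + 1) → V) :
    IsDefinable fun v : V → M01 => cellPredicate α F S T (v x) fun j => v (y j) := by
  classical
  let u : (Fin (n + 1) ⊕ Fin (n + 1) → I) → I := fun p => ⨅ i : Fin (n + 1),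
    min (if i ∈ S then F.minus i (p (.inl i)) else 1)
      (if i ∈ T then F.plus i (p (.inr i)) else 1)
  have hu : Continuous u := by
    have : u = fun p => Finset.univ.inf fun i : Fin (n + 1) =>
        min (if i ∈ S then F.minus i (p (.inl i)) else 1)
          (if i ∈ T then F.plus i (p (.inr i)) else 1) := by
      funext p
      exact (Finset.inf_univ_eq_iInf _).symm
    rw [this]
    refine Continuous.finset_inf_apply fun i _ => Continuous.min ?_ ?_
    · split_ifs <;> fun_prop
    · split_ifs <;> fun_prop
  convert IsDefinable.comp (fun j => isDefinable_phi α x (y j)) hu using 2 with v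
  unfold cellPredicate
  congr!

theorem cellPredicates_finite {n : ℕ} (α : I) (F : CutoffFamily n) :
    (cellPredicates α F).Finite := by
  refine (finite_range fun p : Set (Fin (n + 1)) × Set (Fin (n + 1)) =>
    cellPredicate α F p.1 p.2).subset ?_
  rintro _ ⟨S, T, rfl⟩
  exact ⟨(S, T), rfl⟩

/-! ### The cell decomposition -/

theorem weaklyDefines_cellPredicates {n : ℕ} (hn : 0 < n) {ε : ℝ} (hε : 2 / (n : ℝ) ≤ ε) (α : I)
    (F : CutoffFamily n) : WeaklyDefines (cellPredicates α F) ε (phi α) where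
  definable_pred := isDefinable_phi α 0 1
  finite := cellPredicates_finite α F
  definable := by
    rintro _ ⟨S, T, rfl⟩
    exact isDefinable_cellPredicate α F S T none some
  cell B hB a := by
    obtain ⟨b, hb⟩ := exists_isExtremalChoice n α (B := B) (Finset.card_pos.1 (by omega)) a
    exact ⟨_, ⟨_, _, rfl⟩, b, hb.mem, isGoodCell_cellPredicate hn hε F hb⟩

theorem admitsDistalCellDecomposition_phi (α : I) {ε : ℝ} (hε : 0 < ε) :
    AdmitsDistalCellDecomposition ε (phi α) := by
  obtain ⟨n, hn⟩ := exists_nat_gt (2 / ε)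
  have hn' : (0 : ℝ) < n := lt_trans (by positivity) hn
  have hnε : 2 / (n : ℝ) ≤ ε := by
    rw [div_lt_iff₀ hε] at hn
    rw [div_le_iff₀ hn']
    linarith
  obtain ⟨F⟩ := cutoffFamily_nonempty n
  have hW := weaklyDefines_cellPredicates (by exact_mod_cast hn') hnε α F
  -- Parameters must be indexed by some `Fin k`; here `k = 2(n + 1)`.
  let e : Fin (n + 1) ⊕ Fin (n + 1) ≃ Fin (n + 1 + (n + 1)) := finSumFinEquiv
  refine ⟨_, (fun ψ x y => ψ x fun j => y (e j)) '' cellPredicates α F,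
    hW.definable_pred, hW.finite.image _, ?_, ?_⟩
  · rintro _ ⟨_, ⟨S, T, rfl⟩, rfl⟩
    exact isDefinable_cellPredicate α F S T none fun j => some (e j)
  · intro B hB a
    obtain ⟨ψ, hψ, b, hb, hg⟩ := hW.cell B hB a
    refine ⟨_, ⟨ψ, hψ, rfl⟩, fun j => b (e.symm j), fun j => hb _, ?_⟩
    simpa [IsGoodCell] using hg

end DualContinuum

theorem mainTheorem6 (α : unitInterval) (ε : ℝ) (hε : 0 < ε) :
    DualContinuum.AdmitsDistalCellDecomposition ε (DualContinuum.phi α) ∧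
    ∀ n : ℕ, 0 < n → 2 / (n : ℝ) ≤ ε →
      Nonempty (DualContinuum.CutoffFamily n) ∧
      ∀ F : DualContinuum.CutoffFamily n,
        DualContinuum.WeaklyDefines (DualContinuum.cellPredicates α F) ε (DualContinuum.phi α) ∧
        ∀ (B : Finset DualContinuum.M01), 2 ≤ B.card → ∀ a : DualContinuum.M01,
          (∃ b, DualContinuum.IsExtremalChoice n α B a b) ∧
          ∀ b, DualContinuum.IsExtremalChoice n α B a b →
            DualContinuum.IsGoodCell ε (DualContinuum.phi α) B a
              (DualContinuum.cellPredicate α F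
                {i | (DualContinuum.below n α B a i).Nonempty}
                {i | (DualContinuum.above n α B a i).Nonempty}) b := by
  refine ⟨DualContinuum.admitsDistalCellDecomposition_phi α hε, fun n hn hnε =>
    ⟨DualContinuum.cutoffFamily_nonempty n, fun F =>
      ⟨DualContinuum.weaklyDefines_cellPredicates hn hnε α F, fun B hB a =>
        ⟨DualContinuum.exists_isExtremalChoice n α (Finset.card_pos.1 (by omega)) a,
          fun b hb => DualContinuum.isGoodCell_cellPredicate hn hnε F hb⟩⟩⟩⟩
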